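/- Let $\mathbb T=\{z\in\mathbb C:|z|=1\}$ with normalized Haar measure $\mu$ and Borel $\sigma$-algebra $\mathcal B(\mathbb T)$, let $e_n(z)=z^n$ ($n\in\mathbb Z$) be the standard orthonormal basis of $L^2(\mathbb T,\mu)$, and let $[U(a)f](z)=f(az)$ for $a\in\mathbb T$. Inner products are linear in the second argument, and $|e_n\rangle\langle e_m|$ denotes the operator $f\mapsto\langle e_m|f\rangle\, e_n$. An operator measure is a map $E:\mathcal B(\mathbb T)\to\mathcal L(L^2(\mathbb T,\mu))$ that is $\sigma$-additive in the weak operator topology. It is a $\mathbb T$-covariant localization observable if $E(X)\ge 0$ for all $X$, $E(\mathbb T)=I$, and $U(a)^*E(X)U(a)=E(aX)$ for all $a\in\mathbb T$, $X\in\mathcal B(\mathbb T)$ (equivalently, $V(a)E(X)V(a)^*=E(aX)$ for the translations $[V(a)f](z)=f(a^{-1}z)$). Two such observables $E,E'$ are equivalent if there is a unitary operator $W$ on $L^2(\mathbb T,\mu)$ with $WU(a)=U(a)W$ and $WE(X)=E'(X)W$ for all $a\in\mathbb T$, $X\in\mathcal B(\mathbb T)$. $E$ is projection valued if every $E(X)$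 is an orthogonal projection. **Theorem.** 1. An operator measure $E$ is a $\mathbb T$-covariant localization observable if and only if there is a sequence $(h_n)_{n\in\mathbb Z}$ of unit vectors in $L^2(\mathbb T,\mu)$ such that $$E(X)=\sum_{n,m\in\mathbb Z}\langle h_n|h_m\rangle\int_X z^{m-n}\,d\mu(z)\;|e_n\rangle\langle e_m|,\qquad X\in\mathcal B(\mathbb T),\tag{$*$}$$ where the double series converges in the weak operator topology (its partial sums over finite rectangles $S\times T\subset\mathbb Z\times\mathbb Z$ converge to $E(X)$ as $S$ and $T$ independently increase to $\mathbb Z$). Moreover, for every sequence $(h_n)_{n\in\mathbb Z}$ of unit vectors in $L^2(\mathbb T,\mu)$ there is exactly one operator measure $E$ satisfying $(*)$. 2. Two sequences $(h_n)$ and $(k_n)$ of unit vectors determine the same observable if and only if $\langle h_n|h_m\rangle=\langle k_n|k_m\rangle$ for all $n,m\in\mathbb Z$. 3. If $(h_n)$ and $(h'_n)$ are sequences of unit vectors determining $E$ and $E'$, then $E$ and $E'$ are equivalent if and only if there is a sequence $(z_n)_{n\in\mathbb Z}$ in $\mathbb T$ such that $\langle h'_n|h'_m\rangle=\langle z_nh_n|z_mh_m\rangle$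 for all $n,m\in\mathbb Z$. 4. If $(h_n)$ is a sequence of unit vectors determining $E$, then $E$ is projection valued if and only if there are a unit vector $h\in L^2(\mathbb T,\mu)$ and $z_n\in\mathbb T$ with $h_n=z_nh$ for all $n\in\mathbb Z$. -/

import Mathlib

open MeasureTheory Filter
open scoped Topology Pointwise InnerProductSpace

namespace TorusLocalization

/-- The torus `𝕋 = {z ∈ ℂ : |z| = 1}` carries its Borel `σ`-algebra. -/
noncomputable instance instMeasurableSpaceCircle : MeasurableSpace Circle := borel Circle

instance instBorelSpaceCircle : BorelSpace Circle := ⟨rfl⟩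

/-- The Haar measure on `𝕋`, normalized so that `μ(𝕋) = 1`. -/
noncomputable def haarTorus : Measure Circle :=
  Measure.haarMeasure (⊤ : TopologicalSpace.PositiveCompacts Circle)

instance instIsHaarMeasureHaarTorus : haarTorus.IsHaarMeasure :=
  inferInstanceAs (Measure.haarMeasure _).IsHaarMeasure

instance instIsProbabilityMeasureHaarTorus : IsProbabilityMeasure haarTorus where
  measure_univ := by
    have h := Measure.haarMeasure_self (K₀ := (⊤ : TopologicalSpace.PositiveCompacts Circle))
    rwa [TopologicalSpace.PositiveCompacts.coe_top] at h

/-- The Hilbert space `L²(𝕋, μ)`. Its inner product `⟪f, g⟫_ℂ` is linear in the second slot. -/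
abbrev L2 : Type := Lp ℂ 2 haarTorus

/-- The geometric action `[U(a) f](z) = f(a z)` of `𝕋` on `L²(𝕋, μ)`. -/
noncomputable def U (a : Circle) : L2 →L[ℂ] L2 :=
  (Lp.compMeasurePreservingₗᵢ ℂ (fun z : Circle => a * z)
    (measurePreserving_mul_left haarTorus a)).toContinuousLinearMap

/-- The monomial `e_n(z) = z ^ n`, `n ∈ ℤ`, as an element of `L²(𝕋, μ)`. -/
noncomputable def e (n : ℤ) : L2 :=
  ContinuousMap.toLp 2 haarTorus ℂ
    ⟨fun z : Circle => ((z ^ n : Circle) : ℂ),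
      (show Continuous ((↑) : Circle → ℂ) by fun_prop).comp (continuous_zpow n)⟩

/-- Operator measures `ℬ(𝕋) → 𝓛(L²(𝕋, μ))`: set functions on the Borel sets that are `σ`-additive
for the weak operator topology (`VectorMeasure` has the value `0` off the Borel sets). -/
abbrev OperatorMeasure : Type := VectorMeasure Circle (L2 →WOT[ℂ] L2)

/-- A `𝕋`-covariant localization observable: a positive normalized operator measure `E` with
`U(a)* E(X) U(a) = E(a X)` for all `a ∈ 𝕋` and all Borel sets `X`. -/
structure IsCovariantLocalization (E : OperatorMeasure) : Prop where
  positive : ∀ X : Set Circle, MeasurableSet X → (E X).toCLM.IsPositive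
  normalized : E Set.univ = 1
  covariant : ∀ (a : Circle) (X : Set Circle), MeasurableSet X →
    (U a).adjoint ∘L (E X).toCLM ∘L U a = (E (a • X)).toCLM

/-- `E(X) = ∑_{n, m ∈ ℤ} ⟨h_n | h_m⟩ ∫_X z ^ (m - n) dμ(z) |e_n⟩⟨e_m|` for every Borel set `X`.
The double series converges in the weak operator topology: its partial sums over the finite
rectangles `S × T ⊆ ℤ × ℤ` converge to `E(X)` as `S` and `T` independently increase to `ℤ`. -/
def IsGeneratedBy (E : OperatorMeasure) (h : ℤ → L2) : Prop :=
  ∀ X : Set Circle, MeasurableSet X →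
    Tendsto (fun p : Finset ℤ × Finset ℤ =>
      ContinuousLinearMapWOT.ofCLM (∑ n ∈ p.1, ∑ m ∈ p.2,
        (⟪h n, h m⟫_ℂ * ∫ z in X, ((z ^ (m - n) : Circle) : ℂ) ∂haarTorus) •
          InnerProductSpace.rankOne ℂ (e n) (e m)))
      atTop (𝓝 (E X))

/-- Equivalence of localization observables: a unitary operator `W` of `L²(𝕋, μ)` commutes with
the geometric action and intertwines `E` and `E'`. -/
def AreEquivalent (E E' : OperatorMeasure) : Prop :=
  ∃ W : L2 ≃ₗᵢ[ℂ] L2,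
    (∀ (a : Circle) (f : L2), W (U a f) = U a (W f)) ∧
    (∀ X : Set Circle, MeasurableSet X → ∀ f : L2, W (E X f) = E' X (W f))

/-- `E` is projection valued: each `E(X)` is an orthogonal projection. -/
def IsProjectionValued (E : OperatorMeasure) : Prop :=
  ∀ X : Set Circle, MeasurableSet X → IsStarProjection (E X).toCLM

end TorusLocalization

/-! Everything is read off the matrix entries `⟪e n, E X (e m)⟫_ℂ`. Covariance makes each entry a
complex measure that picks up the factor a ^ (m - n) under rotation by a. It is absolutely
continuous, and its density times z ^ (n - m) is rotation invariant, so the entry is c n m times a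
moment of X (`IsCovariantLocalization.exists_kernel`). Positivity of E makes c positive semidefinite
and normalization gives it unit diagonal, so c is a Gram matrix of unit vectors
(`IsPosSemidefKernel.exists_inner_eq`).

Conversely, unit vectors h n define an isometry sending e n to z ↦ z ^ n • h n, and compressing
multiplication by indicators along it gives the measure (`generatedMeasure`).

Some Borel set has nonzero moment of any given order, so E determines the Gram matrix. A unitary
commuting with all U a is diagonal in the e n, which accounts for the phases in the equivalence.
Idempotence, compared with Parseval for indicators, forces equality in Cauchy-Schwarz between all h
n. -/

namespace TorusLocalization

open scoped ComplexConjugate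

/-! ### Characters and the Fourier basis -/

/-- The character `z ↦ z ^ n` of the torus as a continuous complex-valued function. -/
noncomputable def char (n : ℤ) : C(Circle, ℂ) :=
  ⟨fun z : Circle => ((z ^ n : Circle) : ℂ),
    (show Continuous ((↑) : Circle → ℂ) by fun_prop).comp (continuous_zpow n)⟩

theorem char_apply (n : ℤ) (z : Circle) : char n z = ((z ^ n : Circle) : ℂ) := rfl

theorem char_zero (z : Circle) : char 0 z = 1 := by simp [char_apply]

theorem char_add (m n : ℤ) (z : Circle) : char (m + n) z = char m z * char n z := by
  simp [char_apply, zpow_add]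

theorem char_neg (n : ℤ) (z : Circle) : char (-n) z = conj (char n z) := by
  rw [char_apply, char_apply, zpow_neg, Circle.coe_inv_eq_conj]

theorem char_sub (m n : ℤ) (z : Circle) : char (m - n) z = char m z * conj (char n z) := by
  rw [sub_eq_add_neg, char_add, char_neg]

theorem char_mul (n : ℤ) (a z : Circle) : char n (a * z) = char n a * char n z := by
  simp [char_apply, mul_zpow]

theorem norm_char (n : ℤ) (z : Circle) : ‖char n z‖ = 1 := Circle.norm_coe _

theorem char_ne_zero (n : ℤ) (z : Circle) : char n z ≠ 0 := Circle.coe_ne_zero _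

theorem integrable_char (n : ℤ) : Integrable (char n) haarTorus :=
  (char n).continuous.integrable_of_hasCompactSupport (HasCompactSupport.of_compactSpace _)

theorem coeFn_e (n : ℤ) : e n =ᵐ[haarTorus] char n :=
  ContinuousMap.coeFn_toLp haarTorus (char n)

/-- A nontrivial character is different from `1` somewhere. -/
theorem exists_char_ne_one {k : ℤ} (hk : k ≠ 0) : ∃ a : Circle, char k a ≠ 1 := by
  -- The k-th power of this point is -1.
  refine ⟨Circle.exp (Real.pi / k), ?_⟩
  have hk' : (k : ℝ) ≠ 0 := by exact_mod_cast hk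
  have : (Circle.exp (Real.pi / k)) ^ k = Circle.exp Real.pi := by
    rw [← Circle.exp_zsmul, zsmul_eq_mul, mul_div_cancel₀ _ hk']
  rw [char_apply, this, Circle.coe_exp, Complex.exp_pi_mul_I]
  norm_num

theorem integral_char (k : ℤ) : ∫ z, char k z ∂haarTorus = if k = 0 then 1 else 0 := by
  split_ifs with hk
  · simp [hk, char_zero]
  · obtain ⟨a, ha⟩ := exists_char_ne_one hk
    have h := integral_mul_left_eq_self (μ := haarTorus) (char k) a
    simp_rw [char_mul, integral_const_mul] at h
    have : (char k a - 1) * ∫ z, char k z ∂haarTorus = 0 := by rw [sub_mul, h, one_mul, sub_self]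
    exact (mul_eq_zero.mp this).resolve_left (sub_ne_zero.mpr ha)

theorem inner_e (n m : ℤ) : ⟪e n, e m⟫_ℂ = if n = m then 1 else 0 := by
  have h := ContinuousMap.inner_toLp (𝕜 := ℂ) haarTorus (char n) (char m)
  change ⟪e n, e m⟫_ℂ = _ at h
  simp_rw [h, ← char_sub, integral_char, sub_eq_zero, eq_comm]

theorem orthonormal_e : Orthonormal ℂ e := by
  rw [orthonormal_iff_ite]
  exact inner_e

/-- The star subalgebra of `C(𝕋, ℂ)` generated by the characters. -/
noncomputable def charSubalgebra : StarSubalgebra ℂ C(Circle, ℂ) where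
  toSubalgebra := Algebra.adjoin ℂ (Set.range char)
  star_mem' := by
    change Algebra.adjoin ℂ (Set.range char) ≤ star (Algebra.adjoin ℂ (Set.range char))
    refine Algebra.adjoin_le ?_
    rintro - ⟨n, rfl⟩
    exact Algebra.subset_adjoin ⟨-n, ContinuousMap.ext fun _ => char_neg _ _⟩

theorem toSubmodule_charSubalgebra :
    Subalgebra.toSubmodule charSubalgebra.toSubalgebra = Submodule.span ℂ (Set.range char) := by
  apply Algebra.adjoin_eq_span_of_subset
  refine Set.Subset.trans ?_ Submodule.subset_span
  intro x hx
  refine Submonoid.closure_induction (fun _ => id) ⟨0, ContinuousMap.ext char_zero⟩ ?_ hx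
  rintro - - - - ⟨m, rfl⟩ ⟨n, rfl⟩
  exact ⟨m + n, ContinuousMap.ext fun z => char_add m n z⟩

theorem separatesPoints_charSubalgebra : charSubalgebra.SeparatesPoints := by
  intro x y hxy
  refine ⟨_, ⟨char 1, Algebra.subset_adjoin ⟨1, rfl⟩, rfl⟩, ?_⟩
  simpa [char_apply, Circle.ext_iff] using hxy

/-- Stone-Weierstrass; the span of the characters is already a star subalgebra. -/
theorem topologicalClosure_span_char :
    (Submodule.span ℂ (Set.range char)).topologicalClosure = ⊤ := by
  rw [← toSubmodule_charSubalgebra]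
  exact congr_arg (Subalgebra.toSubmodule <| StarSubalgebra.toSubalgebra ·)
    (ContinuousMap.starSubalgebra_topologicalClosure_eq_top_of_separatesPoints charSubalgebra
      separatesPoints_charSubalgebra)

theorem topologicalClosure_span_e :
    (Submodule.span ℂ (Set.range e)).topologicalClosure = ⊤ := by
  convert!
    (ContinuousMap.toLp_denseRange ℂ haarTorus ℂ
      ENNReal.ofNat_ne_top).topologicalClosure_map_submodule topologicalClosure_span_char using 2
  rw [Submodule.map_span, ← Set.range_comp]
  rfl

/-- The monomials form a Hilbert basis of `L²(𝕋, μ)`. -/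
noncomputable def eBasis : HilbertBasis ℤ ℂ L2 :=
  HilbertBasis.mk orthonormal_e topologicalClosure_span_e.ge

@[simp]
theorem coe_eBasis : ⇑eBasis = e := HilbertBasis.coe_mk _ _

theorem U_apply_e (a : Circle) (n : ℤ) : U a (e n) = char n a • e n := by
  apply Lp.ext
  have h1 : U a (e n) =ᵐ[haarTorus] (e n) ∘ (fun z : Circle => a * z) :=
    Lp.coeFn_compMeasurePreserving _ (measurePreserving_mul_left haarTorus a)
  have h2 := (measurePreserving_mul_left haarTorus a).quasiMeasurePreserving.ae_eq_comp (coeFn_e n)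
  filter_upwards [h1, h2, Lp.coeFn_smul (char n a) (e n), coeFn_e n] with z h1 h2 h3 h4
  rw [h1, h2, h3, Pi.smul_apply, h4, Function.comp_apply, char_mul, smul_eq_mul]

/-! ### Moments of Borel sets -/

/-- The moments `∫_X z ^ k dμ(z)` of a Borel set. -/
noncomputable def moment (X : Set Circle) (k : ℤ) : ℂ :=
  ∫ z in X, char k z ∂haarTorus

theorem moment_univ (k : ℤ) : moment Set.univ k = if k = 0 then 1 else 0 := by
  rw [moment, Measure.restrict_univ, integral_char]

theorem moment_smul (a : Circle) (X : Set Circle) (k : ℤ) :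
    moment (a • X) k = char k a * moment X k := by
  have h := (measurePreserving_mul_left haarTorus a).setIntegral_image_emb
    (MeasurableEquiv.mulLeft a).measurableEmbedding (char k) X
  simp_rw [char_mul, integral_const_mul] at h
  exact h

/-- A character vanishes nowhere, so its set integrals cannot all be zero. This permits cancelling
the moment in an identity between matrix entries. -/
theorem exists_moment_ne_zero (k : ℤ) : ∃ X, MeasurableSet X ∧ moment X k ≠ 0 := by
  by_contra! h
  have h0 := (integrable_char k).ae_eq_zero_of_forall_setIntegral_eq_zero
    fun s hs _ => h s hs
  obtain ⟨z, hz⟩ := h0.exists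
  exact char_ne_zero k z hz

theorem memLp_indicator_char {X : Set Circle} (hX : MeasurableSet X) (n : ℤ) :
    MemLp (X.indicator (char n)) 2 haarTorus :=
  ((char n).continuous.memLp_of_hasCompactSupport (HasCompactSupport.of_compactSpace _)).indicator hX

/-- Parseval for the functions 1_X z ^ n and 1_X z ^ m, whose product collapses because an indicator
is idempotent. -/
theorem hasSum_moment_mul_moment {X : Set Circle} (hX : MeasurableSet X) (n m : ℤ) :
    HasSum (fun k => moment X (k - n) * moment X (m - k)) (moment X (m - n)) := by
  have key (f : Circle → ℂ) (g : Circle → ℂ) (hf : MemLp f 2 haarTorus) (hg : MemLp g 2 haarTorus)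
      (i j : ℤ) (hfg : ∀ z, conj (f z) * g z = X.indicator (char (j - i)) z) :
      ⟪hf.toLp f, hg.toLp g⟫_ℂ = moment X (j - i) := by
    rw [L2.inner_def, moment, ← integral_indicator hX]
    refine integral_congr_ae ?_
    filter_upwards [hf.coeFn_toLp, hg.coeFn_toLp] with z h1 h2
    rw [h1, h2, RCLike.inner_apply, ← hfg, mul_comm]
  have he (k : ℤ) : MemLp (char k) 2 haarTorus :=
    (char k).continuous.memLp_of_hasCompactSupport (HasCompactSupport.of_compactSpace _)
  have hek (k : ℤ) : (he k).toLp = e k := by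
    apply Lp.ext
    exact (he k).coeFn_toLp.trans (coeFn_e k).symm
  have h := eBasis.hasSum_inner_mul_inner ((memLp_indicator_char hX n).toLp)
    ((memLp_indicator_char hX m).toLp)
  rw [key _ _ _ _ n m] at h
  · refine h.congr_fun ?_
    intro k
    rw [coe_eBasis, ← hek, key _ _ _ _ n k, key _ _ _ _ k m]
    all_goals
      intro z
      by_cases hz : z ∈ X <;> simp [hz, char_sub, mul_comm]
  · intro z
    by_cases hz : z ∈ X <;> simp [hz, char_sub, mul_comm]

/-! ### Matrix entries and rectangular truncations -/

theorem ext_inner_e_left {f g : L2} (h : ∀ n, ⟪e n, f⟫_ℂ = ⟪e n, g⟫_ℂ) : f = g := by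
  apply eBasis.repr.injective
  ext n
  simp_rw [HilbertBasis.repr_apply_apply, coe_eBasis, h]

theorem clm_ext_e {H : Type*} [NormedAddCommGroup H] [NormedSpace ℂ H] {A B : L2 →L[ℂ] H}
    (h : ∀ n, A (e n) = B (e n)) : A = B := by
  refine ContinuousLinearMap.ext_on
    (Submodule.dense_iff_topologicalClosure_eq_top.mpr topologicalClosure_span_e) ?_
  rintro - ⟨n, rfl⟩
  exact h n

/-- Bounded operators on `L²(𝕋, μ)` are determined by their matrix entries. -/
theorem clm_ext_inner_e {A B : L2 →L[ℂ] L2} (h : ∀ n m, ⟪e n, A (e m)⟫_ℂ = ⟪e n, B (e m)⟫_ℂ) :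
    A = B :=
  clm_ext_e fun m => ext_inner_e_left fun n => h n m

/-- The Fourier series of `f` converges to `f` in `L²(𝕋, μ)`. -/
theorem tendsto_sum_inner_smul_e (f : L2) :
    Tendsto (fun S : Finset ℤ => ∑ n ∈ S, ⟪e n, f⟫_ℂ • e n) atTop (𝓝 f) := by
  have h := eBasis.hasSum_repr f
  simp_rw [HilbertBasis.repr_apply_apply, coe_eBasis] at h
  exact h

/-- Every bounded operator on `L²(𝕋, μ)` is the limit of its finite rectangular truncations in the
weak operator topology. -/
theorem tendsto_sum_inner_smul_rankOne (A : L2 →L[ℂ] L2) :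
    Tendsto (fun p : Finset ℤ × Finset ℤ =>
      ContinuousLinearMapWOT.ofCLM (∑ n ∈ p.1, ∑ m ∈ p.2,
        ⟪e n, A (e m)⟫_ℂ • InnerProductSpace.rankOne ℂ (e n) (e m)))
      atTop (𝓝 (ContinuousLinearMapWOT.ofCLM A)) := by
  rw [ContinuousLinearMapWOT.tendsto_iff_forall_inner_apply_tendsto]
  intro x y
  -- Truncating to a rectangle truncates the Fourier series of y and x independently, so joint
  -- continuity of the inner product suffices and no summability of the entries is needed.
  have h1 : Tendsto (fun p : Finset ℤ × Finset ℤ =>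
      ⟪∑ n ∈ p.1, ⟪e n, y⟫_ℂ • e n, A (∑ m ∈ p.2, ⟪e m, x⟫_ℂ • e m)⟫_ℂ) atTop
      (𝓝 ⟪y, A x⟫_ℂ) := by
    rw [← prod_atTop_atTop_eq]
    exact ((tendsto_sum_inner_smul_e y).comp tendsto_fst).inner
      ((A.continuous.tendsto x).comp ((tendsto_sum_inner_smul_e x).comp tendsto_snd))
  refine h1.congr fun p => ?_
  simp only [ContinuousLinearMapWOT.ofCLM_apply, _root_.sum_apply, inner_sum, map_sum,
    sum_inner, _root_.smul_apply, inner_smul_left, inner_smul_right, map_smul,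
    InnerProductSpace.rankOne_apply, inner_conj_symm]
  rw [Finset.sum_comm]
  refine Finset.sum_congr rfl fun n _ => ?_
  rw [Finset.mul_sum]
  refine Finset.sum_congr rfl fun m _ => ?_
  ring

/-- The continuous functional `A ↦ ⟨f | A g⟩` on bounded operators. -/
noncomputable def matrixCoeff (f g : L2) : (L2 →WOT[ℂ] L2) →+ ℂ where
  toFun A := ⟪f, A g⟫_ℂ
  map_zero' := by simp
  map_add' A B := by simp [inner_add_right]

theorem matrixCoeff_apply (f g : L2) (A : L2 →WOT[ℂ] L2) : matrixCoeff f g A = ⟪f, A g⟫_ℂ := rfl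

theorem continuous_matrixCoeff (f g : L2) : Continuous (matrixCoeff f g) :=
  ContinuousLinearMapWOT.continuous_iff.mp continuous_id g f

/-- `E` is generated by `h` iff its matrix entries are `⟨h_n | h_m⟩ ∫_X z ^ (m - n) dμ(z)`. -/
theorem isGeneratedBy_iff {E : OperatorMeasure} {h : ℤ → L2} :
    IsGeneratedBy E h ↔ ∀ X, MeasurableSet X → ∀ n m,
      ⟪e n, E X (e m)⟫_ℂ = ⟪h n, h m⟫_ℂ * moment X (m - n) := by
  refine forall₂_congr fun X _ => ⟨fun hE n m => ?_, fun hE => ?_⟩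
  · rw [ContinuousLinearMapWOT.tendsto_iff_forall_inner_apply_tendsto] at hE
    -- The (n, m) entry of the partial sum is constant once the rectangle contains (n, m).
    refine tendsto_nhds_unique (hE (e m) (e n)) (tendsto_const_nhds.congr' ?_)
    filter_upwards [eventually_ge_atTop (({n}, {m}) : Finset ℤ × Finset ℤ)] with p hp
    have hn : n ∈ p.1 := Finset.singleton_subset_iff.mp hp.1
    have hm : m ∈ p.2 := Finset.singleton_subset_iff.mp hp.2
    simp [inner_sum, inner_smul_right, inner_e, hn, hm, moment, char_apply]
  · have := tendsto_sum_inner_smul_rankOne (E X).toCLM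
    simp only [ContinuousLinearMapWOT.toCLM_apply, hE] at this
    exact this

theorem operatorMeasure_ext {E F : OperatorMeasure}
    (h : ∀ X, MeasurableSet X → ∀ n m, ⟪e n, E X (e m)⟫_ℂ = ⟪e n, F X (e m)⟫_ℂ) : E = F :=
  VectorMeasure.ext fun X hX => ContinuousLinearMapWOT.toCLM_injective
    (clm_ext_inner_e fun n m => h X hX n m)

/-- An observable determines the Gram matrix of each generating sequence. -/
theorem IsGeneratedBy.eq_iff {E F : OperatorMeasure} {h k : ℤ → L2} (hE : IsGeneratedBy E h)
    (hF : IsGeneratedBy F k) : E = F ↔ ∀ n m, ⟪h n, h m⟫_ℂ = ⟪k n, k m⟫_ℂ := by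
  rw [isGeneratedBy_iff] at hE hF
  refine ⟨?_, fun H => operatorMeasure_ext fun X hX n m => by rw [hE X hX, hF X hX, H]⟩
  rintro rfl n m
  obtain ⟨X, hX, hne⟩ := exists_moment_ne_zero (m - n)
  exact mul_right_cancel₀ hne ((hE X hX n m).symm.trans (hF X hX n m))

/-! ### Dilation and the measure generated by a sequence -/

/-- The vector-valued monomial `z ↦ z ^ n • h n` as an element of `L²(𝕋, μ; L²(𝕋, μ))`. -/
noncomputable def twistedMonomial (h : ℤ → L2) (n : ℤ) : Lp L2 2 haarTorus :=
  ContinuousMap.toLp 2 haarTorus ℂ ⟨fun z => char n z • h n, by fun_prop⟩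

theorem coeFn_twistedMonomial (h : ℤ → L2) (n : ℤ) :
    twistedMonomial h n =ᵐ[haarTorus] fun z => char n z • h n :=
  ContinuousMap.coeFn_toLp haarTorus _

theorem setIntegral_inner_twistedMonomial (h : ℤ → L2) (n m : ℤ) (X : Set Circle) :
    ∫ z in X, ⟪twistedMonomial h n z, twistedMonomial h m z⟫_ℂ ∂haarTorus =
      ⟪h n, h m⟫_ℂ * moment X (m - n) := by
  rw [moment, ← integral_const_mul]
  refine integral_congr_ae (ae_restrict_of_ae ?_)
  filter_upwards [coeFn_twistedMonomial h n, coeFn_twistedMonomial h m] with z h1 h2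
  rw [h1, h2, inner_smul_left, inner_smul_right, char_sub]
  ring

theorem orthonormal_twistedMonomial {h : ℤ → L2} (hh : ∀ n, ‖h n‖ = 1) :
    Orthonormal ℂ (twistedMonomial h) := by
  rw [orthonormal_iff_ite]
  intro n m
  have := setIntegral_inner_twistedMonomial h n m Set.univ
  rw [Measure.restrict_univ, moment_univ] at this
  rw [L2.inner_def, this]
  by_cases hnm : n = m
  · simp [hnm, inner_self_eq_norm_sq_to_K, hh]
  · simp [hnm, sub_eq_zero, Ne.symm hnm]

/-- The isometry `L²(𝕋, μ) → L²(𝕋, μ; L²(𝕋, μ))` that sends `e_n` to `z ↦ z ^ n • h n`. -/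
noncomputable def dilation {h : ℤ → L2} (hh : ∀ n, ‖h n‖ = 1) : L2 →ₗᵢ[ℂ] Lp L2 2 haarTorus :=
  (orthonormal_twistedMonomial hh).orthogonalFamily.linearIsometry.comp
    eBasis.repr.toLinearIsometry

theorem dilation_e {h : ℤ → L2} (hh : ∀ n, ‖h n‖ = 1) (n : ℤ) :
    dilation hh (e n) = twistedMonomial h n := by
  have := eBasis.repr_self n
  rw [coe_eBasis] at this
  simp [dilation, this, OrthogonalFamily.linearIsometry_apply_single]

/-- The compression to `L²(𝕋, μ)` of the multiplication by the indicator function of `X`. -/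
noncomputable def compression {h : ℤ → L2} (hh : ∀ n, ‖h n‖ = 1) (X : Set Circle) :
    L2 →L[ℂ] L2 :=
  let R := LpToLpRestrictCLM Circle L2 ℂ haarTorus 2 X ∘L (dilation hh).toContinuousLinearMap
  R.adjoint ∘L R

theorem isPositive_compression {h : ℤ → L2} (hh : ∀ n, ‖h n‖ = 1) (X : Set Circle) :
    (compression hh X).IsPositive :=
  ContinuousLinearMap.isPositive_adjoint_comp_self _

theorem inner_compression {h : ℤ → L2} (hh : ∀ n, ‖h n‖ = 1) (X : Set Circle) (f g : L2) :
    ⟪f, compression hh X g⟫_ℂ =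
      ∫ z in X, ⟪dilation hh f z, dilation hh g z⟫_ℂ ∂haarTorus := by
  rw [compression, ContinuousLinearMap.comp_apply, ContinuousLinearMap.adjoint_inner_right,
    L2.inner_def]
  refine integral_congr_ae ?_
  filter_upwards [LpToLpRestrictCLM_coeFn ℂ X (dilation hh f),
    LpToLpRestrictCLM_coeFn ℂ X (dilation hh g)] with z h1 h2
  exact congr_arg₂ _ h1 h2

theorem inner_compression_e {h : ℤ → L2} (hh : ∀ n, ‖h n‖ = 1) (X : Set Circle) (n m : ℤ) :
    ⟪e n, compression hh X (e m)⟫_ℂ = ⟪h n, h m⟫_ℂ * moment X (m - n) := by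
  rw [inner_compression, dilation_e, dilation_e, setIntegral_inner_twistedMonomial]

open scoped Classical in
/-- The operator measure generated by a sequence of unit vectors. -/
noncomputable def generatedMeasure {h : ℤ → L2} (hh : ∀ n, ‖h n‖ = 1) : OperatorMeasure where
  measureOf' X := if MeasurableSet X then ContinuousLinearMapWOT.ofCLM (compression hh X) else 0
  empty' := by
    rw [if_pos MeasurableSet.empty]
    ext x y
    simp [inner_compression]
  not_measurable' X hX := if_neg hX
  m_iUnion' X hX hd := by
    simp_rw [if_pos (MeasurableSet.iUnion hX), if_pos (hX _)]
    rw [HasSum, ContinuousLinearMapWOT.tendsto_iff_forall_inner_apply_tendsto]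
    intro x y
    -- Weak σ-additivity is countable additivity of the integral of one fixed integrable function.
    have := hasSum_integral_iUnion hX hd
      (L2.integrable_inner (𝕜 := ℂ) (dilation hh y) (dilation hh x)).integrableOn
    simp_rw [← matrixCoeff_apply, map_sum, matrixCoeff_apply, ContinuousLinearMapWOT.ofCLM_apply,
      inner_compression]
    exact this

theorem generatedMeasure_apply {h : ℤ → L2} (hh : ∀ n, ‖h n‖ = 1) {X : Set Circle}
    (hX : MeasurableSet X) : (generatedMeasure hh X).toCLM = compression hh X := by
  classical
  exact congr_arg ContinuousLinearMapWOT.toCLM (if_pos hX)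

theorem isGeneratedBy_generatedMeasure {h : ℤ → L2} (hh : ∀ n, ‖h n‖ = 1) :
    IsGeneratedBy (generatedMeasure hh) h := by
  rw [isGeneratedBy_iff]
  intro X hX n m
  rw [← ContinuousLinearMapWOT.toCLM_apply, generatedMeasure_apply hh hX, inner_compression_e]

theorem IsGeneratedBy.eq_generatedMeasure {E : OperatorMeasure} {h : ℤ → L2}
    (hE : IsGeneratedBy E h) (hh : ∀ n, ‖h n‖ = 1) : E = generatedMeasure hh :=
  (hE.eq_iff (isGeneratedBy_generatedMeasure hh)).mpr fun _ _ => rfl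

theorem IsGeneratedBy.isCovariantLocalization {E : OperatorMeasure} {h : ℤ → L2}
    (hE : IsGeneratedBy E h) (hh : ∀ n, ‖h n‖ = 1) : IsCovariantLocalization E where
  positive X hX := by
    rw [hE.eq_generatedMeasure hh, generatedMeasure_apply hh hX]
    exact isPositive_compression hh X
  normalized := by
    refine ContinuousLinearMapWOT.toCLM_injective (clm_ext_inner_e fun n m => ?_)
    have := isGeneratedBy_iff.mp hE _ MeasurableSet.univ n m
    rw [ContinuousLinearMapWOT.toCLM_apply, this, moment_univ, ContinuousLinearMapWOT.toCLM_one,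
      one_apply_eq_self, inner_e]
    by_cases hnm : n = m
    · simp [hnm, inner_self_eq_norm_sq_to_K, hh]
    · simp [hnm, sub_eq_zero, Ne.symm hnm]
  covariant a X hX := by
    refine clm_ext_inner_e fun n m => ?_
    have h1 := isGeneratedBy_iff.mp hE _ hX n m
    have h2 := isGeneratedBy_iff.mp hE _ (hX.const_smul a) n m
    rw [ContinuousLinearMap.comp_apply, ContinuousLinearMap.adjoint_inner_right,
      ContinuousLinearMap.comp_apply, U_apply_e, U_apply_e, map_smul, inner_smul_left,
      inner_smul_right, ContinuousLinearMapWOT.toCLM_apply, ContinuousLinearMapWOT.toCLM_apply,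
      h1, h2, moment_smul, char_sub]
    ring

/-! ### Positive semidefinite kernels as Gram matrices -/

section Positivity

open scoped ComplexOrder

/-- The 2 × 2 case: a positive semidefinite matrix with unit diagonal has off-diagonal entries of
modulus at most 1. -/
theorem norm_le_one_of_forall_nonneg {c d : ℂ}
    (h : ∀ a b : ℂ, 0 ≤ conj a * a + conj a * b * c + (conj b * a * d + conj b * b)) :
    ‖c‖ ≤ 1 := by
  -- Reality of the form at (1, 1) and (1, i) forces d to be the conjugate of c.
  have h1 := (Complex.le_def.mp (h 1 1)).2
  have h2 := (Complex.le_def.mp (h 1 Complex.I)).2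
  have hd : d = conj c := by
    apply Complex.ext
    · simp at h2 ⊢; linarith
    · simp at h1 ⊢; linarith
  -- At this vector the form equals 2‖c‖²(1 - ‖c‖).
  have h3 := (Complex.le_def.mp (h c (-‖c‖))).1
  have hcc : conj c * c = ((‖c‖ ^ 2 : ℝ) : ℂ) := by
    rw [mul_comm, Complex.mul_conj, Complex.normSq_eq_norm_sq]
  have h4 : conj c * c + conj c * (-‖c‖ : ℂ) * c +
      (conj (-‖c‖ : ℂ) * c * d + conj (-‖c‖ : ℂ) * (-‖c‖ : ℂ)) =
      ((2 * ‖c‖ ^ 2 * (1 - ‖c‖) : ℝ) : ℂ) := by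
    rw [hd, map_neg, Complex.conj_ofReal]
    push_cast at hcc ⊢
    linear_combination (1 - 2 * (‖c‖ : ℂ)) * hcc
  rw [h4, Complex.ofReal_re, Complex.zero_re] at h3
  by_contra! hlt
  have : 0 < ‖c‖ ^ 2 := by positivity
  nlinarith

/-- A kernel on `ℤ` is positive semidefinite if all its finite quadratic forms are nonnegative. -/
def IsPosSemidefKernel (c : ℤ → ℤ → ℂ) : Prop :=
  ∀ (S : Finset ℤ) (x : ℤ → ℂ), 0 ≤ ∑ n ∈ S, ∑ m ∈ S, conj (x n) * x m * c n m

theorem IsPosSemidefKernel.norm_le_one {c : ℤ → ℤ → ℂ} (hc : IsPosSemidefKernel c)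
    (h1 : ∀ n, c n n = 1) (n m : ℤ) : ‖c n m‖ ≤ 1 := by
  by_cases hnm : n = m
  · simp [hnm, h1]
  refine norm_le_one_of_forall_nonneg (d := c m n) fun a b => ?_
  have := hc {n, m} fun k => if k = n then a else b
  simpa [Finset.sum_pair hnm, h1, Ne.symm hnm] using this

/-- A bounded positive semidefinite kernel, rescaled by summable weights, is the matrix of a
positive operator. -/
theorem IsPosSemidefKernel.exists_isPositive {c : ℤ → ℤ → ℂ} (hc : IsPosSemidefKernel c)
    (hb : ∀ n m, ‖c n m‖ ≤ 1) {w : ℤ → ℝ} (hw0 : ∀ n, 0 ≤ w n) (hw : Summable w) :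
    ∃ C : L2 →L[ℂ] L2, C.IsPositive ∧ ∀ n m, ⟪e n, C (e m)⟫_ℂ = w n * w m * c n m := by
  have hs : Summable fun p : ℤ × ℤ =>
      ((w p.1 * w p.2 : ℂ) * c p.1 p.2) • InnerProductSpace.rankOne ℂ (e p.1) (e p.2) := by
    refine Summable.of_norm_bounded (hw.mul_of_nonneg hw hw0 hw0) fun p => ?_
    rw [norm_smul, InnerProductSpace.norm_rankOne, orthonormal_e.1, orthonormal_e.1, norm_mul,
      norm_mul, Complex.norm_of_nonneg (hw0 _), Complex.norm_of_nonneg (hw0 _), mul_one, mul_one]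
    exact mul_le_of_le_one_right (mul_nonneg (hw0 _) (hw0 _)) (hb _ _)
  obtain ⟨C, hC⟩ := hs
  have hCe (n m : ℤ) : ⟪e n, C (e m)⟫_ℂ = w n * w m * c n m := by
    have h1 := (hC.mapL (ContinuousLinearMap.apply ℂ L2 (e m))).mapL (innerSL ℂ (e n))
    have h2 := hasSum_single (f := fun p : ℤ × ℤ => (innerSL ℂ (e n))
      ((ContinuousLinearMap.apply ℂ L2 (e m)) (((w p.1 * w p.2 : ℂ) * c p.1 p.2) •
        InnerProductSpace.rankOne ℂ (e p.1) (e p.2)))) (n, m) ?_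
    · have := h1.unique h2
      simpa [inner_smul_right, inner_e, orthonormal_e.1] using this
    · rintro ⟨k, l⟩ hkl
      by_cases hk : n = k
      · have : l ≠ m := fun hl => hkl (by rw [hk, hl])
        simp [inner_e, this]
      · by_cases hl : l = m <;> simp [inner_e, hk, hl]
  refine ⟨C, ?_, hCe⟩
  -- On a partial Fourier sum of f the form of C is the form of c at the vector w n * ⟪e n, f⟫_ℂ;
  -- then pass to the limit.
  have hnn (f : L2) : 0 ≤ ⟪f, C f⟫_ℂ := by
    have hexp := tendsto_sum_inner_smul_e f
    refine ge_of_tendsto' (hexp.inner ((C.continuous.tendsto f).comp hexp)) fun S => ?_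
    have := hc S fun n => w n * ⟪e n, f⟫_ℂ
    convert this using 1
    simp only [Function.comp_apply, map_sum, map_smul, sum_inner, inner_sum, inner_smul_left,
      inner_smul_right, hCe, map_mul, Complex.conj_ofReal]
    rw [Finset.sum_comm]
    simp only [Finset.mul_sum]
    refine Finset.sum_congr rfl fun n _ => Finset.sum_congr rfl fun m _ => ?_
    ring
  rw [ContinuousLinearMap.isPositive_iff_complex]
  intro f
  obtain ⟨h1, h2⟩ := Complex.le_def.mp (hnn f)
  rw [← inner_conj_symm, Complex.conj_re] at h1
  rw [← inner_conj_symm, Complex.conj_im, Complex.zero_im, zero_eq_neg] at h2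
  exact ⟨Complex.ext rfl h2.symm, h1⟩

/-- A positive element of the C*-algebra of operators factors as B* B. -/
theorem exists_inner_eq_of_isPositive {H : Type*} [NormedAddCommGroup H] [InnerProductSpace ℂ H]
    [CompleteSpace H] {C : H →L[ℂ] H} (hC : C.IsPositive) :
    ∃ B : H →L[ℂ] H, ∀ f g, ⟪f, C g⟫_ℂ = ⟪B f, B g⟫_ℂ := by
  obtain ⟨B, hB⟩ := CStarAlgebra.nonneg_iff_eq_star_mul_self.mp
    ((ContinuousLinearMap.nonneg_iff_isPositive C).mpr hC)
  refine ⟨B, fun f g => ?_⟩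
  rw [hB, ContinuousLinearMap.star_eq_adjoint, mul_apply_eq_comp,
    ContinuousLinearMap.adjoint_inner_right]

/-- A normalized positive semidefinite kernel on `ℤ` is the Gram matrix of vectors in
`L²(𝕋, μ)`. -/
theorem IsPosSemidefKernel.exists_inner_eq {c : ℤ → ℤ → ℂ} (hc : IsPosSemidefKernel c)
    (h1 : ∀ n, c n n = 1) : ∃ h : ℤ → L2, ∀ n m, ⟪h n, h m⟫_ℂ = c n m := by
  -- The kernel c itself need not be the matrix of a bounded operator. Any positive summable weights
  -- make it one, and they are divided out again after the factorization.
  obtain ⟨w, hw0, s, hw, -⟩ := posSumOfEncodable one_pos ℤ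
  obtain ⟨C, hC, hCe⟩ := hc.exists_isPositive (hc.norm_le_one h1) (fun n => (hw0 n).le) hw.summable
  obtain ⟨B, hB⟩ := exists_inner_eq_of_isPositive hC
  refine ⟨fun n => ((w n)⁻¹ : ℂ) • B (e n), fun n m => ?_⟩
  have hn : (w n : ℂ) ≠ 0 := by exact_mod_cast (hw0 n).ne'
  have hm : (w m : ℂ) ≠ 0 := by exact_mod_cast (hw0 m).ne'
  rw [inner_smul_left, inner_smul_right, ← hB, hCe, map_inv₀, Complex.conj_ofReal]
  field_simp

/-! ### Rotation covariant densities -/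

/-- A density that is invariant under rotations is constant. -/
theorem ae_eq_const_of_forall_mul_left {f : Circle → ℂ} (hf : Integrable f haarTorus)
    (h : ∀ a : Circle, (fun z => f (a * z)) =ᵐ[haarTorus] f) :
    f =ᵐ[haarTorus] fun _ => ∫ z, f z ∂haarTorus := by
  refine hf.ae_eq_of_forall_setIntegral_eq _ _ (integrable_const _) fun X hX _ => ?_
  -- This shear of the product supplies the joint integrability for Fubini: averaging over rotations
  -- replaces the inner integrand by its mean.
  have hmp : MeasurePreserving (fun p : Circle × Circle => (p.1, p.1 * p.2))
      ((haarTorus.restrict X).prod haarTorus) ((haarTorus.restrict X).prod haarTorus) :=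
    measurePreserving_prod_mul _ _
  have hint : Integrable (Function.uncurry fun z a : Circle => f (z * a))
      ((haarTorus.restrict X).prod haarTorus) :=
    hmp.integrable_comp_of_integrable (hf.comp_snd (haarTorus.restrict X))
  calc ∫ z in X, f z ∂haarTorus
      = ∫ _ : Circle, (∫ z in X, f z ∂haarTorus) ∂haarTorus := by simp
    _ = ∫ a : Circle, (∫ z in X, f (z * a) ∂haarTorus) ∂haarTorus := by
        refine integral_congr_ae (Eventually.of_forall fun a => ?_)
        refine integral_congr_ae (ae_restrict_of_ae ?_)
        filter_upwards [h a] with z hz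
        rw [mul_comm z a, hz]
    _ = ∫ z in X, (∫ a, f (z * a) ∂haarTorus) ∂haarTorus := (integral_integral_swap hint).symm
    _ = ∫ z in X, (∫ a, f a ∂haarTorus) ∂haarTorus := by
        simp_rw [integral_mul_left_eq_self f]

/-- Multiplying f by z ^ (-k) undoes the character factor and leaves an invariant, hence constant,
density. -/
theorem setIntegral_eq_mul_moment {f : Circle → ℂ} (hf : Integrable f haarTorus) {k : ℤ}
    (h : ∀ (a : Circle) (X : Set Circle), MeasurableSet X →
      ∫ z in a • X, f z ∂haarTorus = char k a * ∫ z in X, f z ∂haarTorus) :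
    ∃ c : ℂ, ∀ X, ∫ z in X, f z ∂haarTorus = c * moment X k := by
  have hinv (a : Circle) : (fun z => f (a * z)) =ᵐ[haarTorus] fun z => char k a * f z := by
    refine (hf.comp_mul_left a).ae_eq_of_forall_setIntegral_eq _ _ (hf.const_mul _)
      fun X hX _ => ?_
    rw [integral_const_mul, ← h a X hX]
    exact ((measurePreserving_mul_left haarTorus a).setIntegral_image_emb
      (MeasurableEquiv.mulLeft a).measurableEmbedding f X).symm
  have hg : Integrable (fun z => char (-k) z * f z) haarTorus :=
    hf.bdd_mul (c := 1) (char (-k)).continuous.aestronglyMeasurable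
      (Eventually.of_forall fun z => (norm_char _ z).le)
  have hone (z : Circle) : char k z * char (-k) z = 1 := by
    rw [← char_add, add_neg_cancel, char_zero]
  have hconst := ae_eq_const_of_forall_mul_left hg fun a => by
    filter_upwards [hinv a] with z hz
    rw [hz, char_mul]
    linear_combination (char (-k) z * f z) * hone a
  refine ⟨∫ z, char (-k) z * f z ∂haarTorus, fun X => ?_⟩
  rw [moment, ← integral_const_mul]
  refine integral_congr_ae (ae_restrict_of_ae ?_)
  filter_upwards [hconst] with z hz
  rw [← hz]
  linear_combination (-f z) * hone z

/-- Radon-Nikodym, applied to the real and imaginary parts. -/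
theorem exists_density (c : ComplexMeasure Circle)
    (hc : ∀ X, MeasurableSet X → haarTorus X = 0 → c X = 0) :
    ∃ f : Circle → ℂ, Integrable f haarTorus ∧
      ∀ X, MeasurableSet X → c X = ∫ z in X, f z ∂haarTorus := by
  have key (s : SignedMeasure Circle) (hs : ∀ X, MeasurableSet X → haarTorus X = 0 → s X = 0)
      (X : Set Circle) (hX : MeasurableSet X) :
      s X = ∫ z in X, s.rnDeriv haarTorus z ∂haarTorus := by
    have hac : s ≪ᵥ haarTorus.toENNRealVectorMeasure := by
      refine VectorMeasure.AbsolutelyContinuous.mk fun Y hY hY0 => hs Y hY ?_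
      rwa [Measure.toENNRealVectorMeasure_apply_measurable hY] at hY0
    conv_lhs => rw [← SignedMeasure.withDensityᵥ_rnDeriv_eq s haarTorus hac]
    rw [withDensityᵥ_apply (SignedMeasure.integrable_rnDeriv _ _) hX]
  have hre (X : Set Circle) : ComplexMeasure.re c X = (c X).re := rfl
  have him (X : Set Circle) : ComplexMeasure.im c X = (c X).im := rfl
  refine ⟨c.rnDeriv haarTorus, c.integrable_rnDeriv haarTorus, fun X hX => ?_⟩
  have hi := (c.integrable_rnDeriv haarTorus).integrableOn (s := X)
  apply Complex.ext
  · rw [← hre, key _ (fun Y hY h0 => by rw [hre, hc Y hY h0, Complex.zero_re]) X hX]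
    exact integral_re hi
  · rw [← him, key _ (fun Y hY h0 => by rw [him, hc Y hY h0, Complex.zero_im]) X hX]
    exact integral_im hi

/-- A nonnegative rotation invariant signed measure vanishes on Haar null sets. -/
theorem signedMeasure_eq_zero_of_invariant (s : SignedMeasure Circle)
    (hpos : ∀ X, MeasurableSet X → 0 ≤ s X)
    (hinv : ∀ (a : Circle) (X : Set Circle), MeasurableSet X → s (a • X) = s X)
    {X : Set Circle} (hX : MeasurableSet X) (h0 : haarTorus X = 0) : s X = 0 := by
  have hs : VectorMeasure.restrict 0 Set.univ ≤ VectorMeasure.restrict s Set.univ := by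
    rw [VectorMeasure.restrict_univ, VectorMeasure.restrict_univ]
    exact fun Y hY => hpos Y hY
  set ν := s.toMeasureOfZeroLE Set.univ MeasurableSet.univ hs with hν
  have hνs (Y : Set Circle) (hY : MeasurableSet Y) : ν.real Y = s Y := by
    rw [hν, SignedMeasure.toMeasureOfZeroLE_real_apply _ _ _ hY, Set.univ_inter]
  -- Uniqueness of Haar measure then makes ν a multiple of `haarTorus`.
  have : ν.IsMulLeftInvariant := by
    refine ⟨fun a => Measure.ext fun Y hY => ?_⟩
    have hpre : (fun z => a * z) ⁻¹' Y = a⁻¹ • Y := Set.preimage_smul a Y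
    rw [Measure.map_apply (measurable_const_mul a) hY, hpre, ← measureReal_eq_measureReal_iff,
      hνs _ (hY.const_smul a⁻¹), hνs _ hY, hinv a⁻¹ Y hY]
  rw [← hνs X hX, Measure.isMulLeftInvariant_eq_smul ν haarTorus, measureReal_def,
    Measure.smul_apply, h0, smul_zero, ENNReal.toReal_zero]

/-! ### From covariant observables to generating sequences -/

theorem IsCovariantLocalization.inner_e_smul {E : OperatorMeasure} (hE : IsCovariantLocalization E)
    (a : Circle) {X : Set Circle} (hX : MeasurableSet X) (n m : ℤ) :
    ⟪e n, E (a • X) (e m)⟫_ℂ = char (m - n) a * ⟪e n, E X (e m)⟫_ℂ := by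
  rw [← ContinuousLinearMapWOT.toCLM_apply, ← hE.covariant a X hX, ContinuousLinearMap.comp_apply,
    ContinuousLinearMap.adjoint_inner_right, ContinuousLinearMap.comp_apply, U_apply_e, U_apply_e,
    map_smul, inner_smul_left, inner_smul_right, ContinuousLinearMapWOT.toCLM_apply, char_sub]
  ring

/-- The diagonal entries form a nonnegative invariant measure, so they vanish on null sets; writing
E X = B* B, this entry is ‖B (e m)‖². Hence all entries, including the off-diagonal ones, are
absolutely continuous. -/
theorem IsCovariantLocalization.apply_e_eq_zero {E : OperatorMeasure}
    (hE : IsCovariantLocalization E) {X : Set Circle} (hX : MeasurableSet X)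
    (h0 : haarTorus X = 0) (m : ℤ) : E X (e m) = 0 := by
  let s : SignedMeasure Circle := ComplexMeasure.re
    (E.mapRange (matrixCoeff (e m) (e m)) (continuous_matrixCoeff _ _))
  have hs (Y : Set Circle) : s Y = (⟪e m, E Y (e m)⟫_ℂ).re := rfl
  have hsX : s X = 0 := by
    refine signedMeasure_eq_zero_of_invariant s (fun Y hY => ?_) (fun a Y hY => ?_) hX h0
    · exact (hE.positive Y hY).re_inner_nonneg_right (e m)
    · rw [hs, hs, hE.inner_e_smul a hY, sub_self, char_zero, one_mul]
  obtain ⟨B, hB⟩ := exists_inner_eq_of_isPositive (hE.positive X hX)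
  have hBe : B (e m) = 0 := by
    rw [hs, ← ContinuousLinearMapWOT.toCLM_apply, hB] at hsX
    exact norm_eq_zero.mp (pow_eq_zero_iff two_ne_zero |>.mp
      ((inner_self_eq_norm_sq (𝕜 := ℂ) _).symm.trans hsX))
  refine ext_inner_left ℂ fun f => ?_
  rw [← ContinuousLinearMapWOT.toCLM_apply, hB, hBe, inner_zero_right, inner_zero_right]

/-- The matrix entries of a covariant localization observable. -/
theorem IsCovariantLocalization.exists_kernel {E : OperatorMeasure}
    (hE : IsCovariantLocalization E) : ∃ c : ℤ → ℤ → ℂ, ∀ X, MeasurableSet X → ∀ n m,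
      ⟪e n, E X (e m)⟫_ℂ = c n m * moment X (m - n) := by
  have (n m : ℤ) : ∃ c : ℂ, ∀ X, MeasurableSet X →
      ⟪e n, E X (e m)⟫_ℂ = c * moment X (m - n) := by
    obtain ⟨f, hf, hfX⟩ := exists_density
      (E.mapRange (matrixCoeff (e n) (e m)) (continuous_matrixCoeff _ _)) fun X hX h0 => by
        rw [VectorMeasure.mapRange_apply, matrixCoeff_apply, hE.apply_e_eq_zero hX h0,
          inner_zero_right]
    simp_rw [VectorMeasure.mapRange_apply, matrixCoeff_apply] at hfX
    obtain ⟨c, hc⟩ := setIntegral_eq_mul_moment hf (k := m - n) fun a X hX => by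
      rw [← hfX X hX, ← hfX _ (hX.const_smul a), hE.inner_e_smul a hX]
    exact ⟨c, fun X hX => by rw [hfX X hX, hc]⟩
  choose c hc using this
  exact ⟨c, fun X hX n m => hc n m X hX⟩

/-- Nonnegativity holds almost everywhere, and a conull set is dense, so continuity extends it to
every point. -/
theorem nonneg_of_forall_setIntegral_nonneg (p : C(Circle, ℂ))
    (hp : ∀ X, MeasurableSet X → 0 ≤ ∫ z in X, p z ∂haarTorus) (z : Circle) : 0 ≤ p z := by
  have hpi : Integrable p haarTorus :=
    p.continuous.integrable_of_hasCompactSupport (HasCompactSupport.of_compactSpace _)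
  have hre : 0 ≤ᵐ[haarTorus] fun z => (p z).re :=
    ae_nonneg_of_forall_setIntegral_nonneg hpi.re fun X hX _ => by
      have : ∫ z in X, (p z).re ∂haarTorus = (∫ z in X, p z ∂haarTorus).re :=
        integral_re hpi.integrableOn
      rw [this]
      exact (Complex.le_def.mp (hp X hX)).1
  have him : (fun z => (p z).im) =ᵐ[haarTorus] 0 :=
    hpi.im.ae_eq_zero_of_forall_setIntegral_eq_zero fun X hX _ => by
      have : ∫ z in X, (p z).im ∂haarTorus = (∫ z in X, p z ∂haarTorus).im :=
        integral_im hpi.integrableOn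
      exact this.trans (Complex.le_def.mp (hp X hX)).2.symm
  have hae : ∀ᵐ z ∂haarTorus, 0 ≤ p z := by
    filter_upwards [hre, him] with z h1 h2
    exact Complex.le_def.mpr ⟨h1, h2.symm⟩
  have hcl : IsClosed {z | 0 ≤ p z} := isClosed_le continuous_const p.continuous
  have hd : Dense {z | 0 ≤ p z} := Measure.dense_of_ae hae
  have : z ∈ closure {z | 0 ≤ p z} := hd z
  rwa [hcl.closure_eq] at this

/-- The form of c at x is the value at z = 1 of a trigonometric polynomial whose integral over X is
the form of E X at ∑ x n • e n, hence nonnegative. -/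
theorem isPosSemidefKernel_of_positive {E : OperatorMeasure} {c : ℤ → ℤ → ℂ}
    (hE : ∀ X, MeasurableSet X → (E X).toCLM.IsPositive)
    (hc : ∀ X, MeasurableSet X → ∀ n m, ⟪e n, E X (e m)⟫_ℂ = c n m * moment X (m - n)) :
    IsPosSemidefKernel c := by
  intro S x
  let p : C(Circle, ℂ) := ∑ n ∈ S, ∑ m ∈ S, (conj (x n) * x m * c n m) • char (m - n)
  have hp (z : Circle) : p z = ∑ n ∈ S, ∑ m ∈ S, conj (x n) * x m * c n m * char (m - n) z := by
    simp [p, ContinuousMap.sum_apply]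
  have h1 : p 1 = ∑ n ∈ S, ∑ m ∈ S, conj (x n) * x m * c n m := by
    rw [hp]
    simp [char_apply]
  rw [← h1]
  refine nonneg_of_forall_setIntegral_nonneg p (fun X hX => ?_) 1
  have hint : ∫ z in X, p z ∂haarTorus =
      ⟪∑ n ∈ S, x n • e n, (E X).toCLM (∑ m ∈ S, x m • e m)⟫_ℂ := by
    simp_rw [hp]
    rw [integral_finsetSum _ fun n _ => integrable_finsetSum _ fun m _ =>
      ((integrable_char _).const_mul _).integrableOn]
    simp only [map_sum, sum_inner]
    refine Finset.sum_congr rfl fun n _ => ?_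
    simp only [map_smul, inner_sum, inner_smul_left, inner_smul_right,
      ContinuousLinearMapWOT.toCLM_apply, hc X hX]
    rw [integral_finsetSum _ fun m _ => ((integrable_char _).const_mul _).integrableOn]
    refine Finset.sum_congr rfl fun m _ => ?_
    rw [integral_const_mul, moment]
    ring
  rw [hint]
  exact (hE X hX).inner_nonneg_right _

theorem IsCovariantLocalization.exists_isGeneratedBy {E : OperatorMeasure}
    (hE : IsCovariantLocalization E) :
    ∃ h : ℤ → L2, (∀ n, ‖h n‖ = 1) ∧ IsGeneratedBy E h := by
  obtain ⟨c, hc⟩ := hE.exists_kernel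
  have hdiag (n : ℤ) : c n n = 1 := by
    have := hc _ MeasurableSet.univ n n
    rw [hE.normalized, ContinuousLinearMapWOT.one_apply, inner_e, moment_univ] at this
    simpa using this.symm
  obtain ⟨h, hh⟩ := (isPosSemidefKernel_of_positive hE.positive hc).exists_inner_eq hdiag
  refine ⟨h, fun n => ?_, isGeneratedBy_iff.mpr fun X hX n m => by rw [hc X hX, hh]⟩
  have h2 : ‖h n‖ ^ 2 = 1 := by
    rw [← inner_self_eq_norm_sq (𝕜 := ℂ), hh, hdiag, RCLike.one_re]
  exact (pow_eq_one_iff_of_nonneg (norm_nonneg _) two_ne_zero).mp h2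

end Positivity

/-! ### Unitary equivalence -/

theorem conj_mul_self_circle (z : Circle) : conj (z : ℂ) * z = 1 := by
  rw [mul_comm, Complex.mul_conj, Circle.normSq_coe, Complex.ofReal_one]

theorem inner_U (a : Circle) (f g : L2) : ⟪U a f, U a g⟫_ℂ = ⟪f, g⟫_ℂ := by
  rw [U, LinearIsometry.coe_toContinuousLinearMap, LinearIsometry.inner_map_map]

/-- A unitary operator commuting with all `U a` is diagonal with respect to the monomials. -/
theorem exists_apply_e_eq_smul {W : L2 ≃ₗᵢ[ℂ] L2} (hW : ∀ a f, W (U a f) = U a (W f)) :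
    ∃ z : ℤ → Circle, ∀ n, W (e n) = (z n : ℂ) • e n := by
  have hdiag (n : ℤ) : W (e n) = ⟪e n, W (e n)⟫_ℂ • e n := by
    refine ext_inner_e_left fun k => ?_
    rw [inner_smul_right, inner_e]
    by_cases hk : k = n
    · simp [hk]
    rw [if_neg hk, mul_zero]
    -- For k ≠ n some rotation has different eigenvalues on e k and e n, which kills the entry.
    obtain ⟨a, ha⟩ := exists_char_ne_one (sub_ne_zero.mpr (Ne.symm hk))
    have hU := inner_U a (e k) (W (e n))
    rw [← hW, U_apply_e, U_apply_e, map_smul, inner_smul_left, inner_smul_right] at hU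
    have h0 : (char (n - k) a - 1) * ⟪e k, W (e n)⟫_ℂ = 0 := by
      rw [char_sub]
      linear_combination hU
    exact (mul_eq_zero.mp h0).resolve_left (sub_ne_zero.mpr ha)
  have hnorm (n : ℤ) : ‖⟪e n, W (e n)⟫_ℂ‖ = 1 := by
    have := congr_arg norm (hdiag n)
    rw [norm_smul, W.norm_map, orthonormal_e.1, mul_one] at this
    exact this.symm
  exact ⟨fun n => ⟨_, mem_sphere_zero_iff_norm.mpr (hnorm n)⟩, hdiag⟩

/-- Rescaling the monomials by phases is a unitary operator. -/
theorem exists_linearIsometryEquiv_apply_e (z : ℤ → Circle) :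
    ∃ W : L2 ≃ₗᵢ[ℂ] L2, ∀ n, W (e n) = (z n : ℂ) • e n := by
  have ho : Orthonormal ℂ fun n => (z n : ℂ) • e n := by
    rw [orthonormal_iff_ite]
    intro n m
    rw [inner_smul_left, inner_smul_right, inner_e]
    split_ifs with h
    · rw [h, mul_one, conj_mul_self_circle]
    · simp
  have hsp : ⊤ ≤ (Submodule.span ℂ (Set.range fun n => (z n : ℂ) • e n)).topologicalClosure := by
    rw [← topologicalClosure_span_e]
    refine Submodule.topologicalClosure_mono (Submodule.span_le.mpr ?_)
    rintro - ⟨n, rfl⟩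
    have := Submodule.smul_mem _ (conj (z n : ℂ))
      (Submodule.subset_span (R := ℂ) (Set.mem_range_self (f := fun n => (z n : ℂ) • e n) n))
    rwa [smul_smul, conj_mul_self_circle, one_smul] at this
  refine ⟨eBasis.repr.trans (HilbertBasis.mk ho hsp).repr.symm, fun n => ?_⟩
  have h1 := eBasis.repr_self n
  rw [coe_eBasis] at h1
  rw [LinearIsometryEquiv.trans_apply, h1, HilbertBasis.repr_symm_single, HilbertBasis.coe_mk]

theorem IsGeneratedBy.areEquivalent_iff {E E' : OperatorMeasure} {h h' : ℤ → L2}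
    (hE : IsGeneratedBy E h) (hE' : IsGeneratedBy E' h') :
    AreEquivalent E E' ↔ ∃ z : ℤ → Circle, ∀ n m,
      ⟪h' n, h' m⟫_ℂ = ⟪(z n : ℂ) • h n, (z m : ℂ) • h m⟫_ℂ := by
  rw [isGeneratedBy_iff] at hE hE'
  constructor
  · rintro ⟨W, hWU, hWE⟩
    obtain ⟨z, hz⟩ := exists_apply_e_eq_smul hWU
    -- The eigenvalues of W carry the Gram matrix of h' to that of h, so the phases on h are their
    -- inverses.
    refine ⟨fun n => (z n)⁻¹, fun n m => ?_⟩
    obtain ⟨X, hX, hne⟩ := exists_moment_ne_zero (m - n)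
    have h1 := W.inner_map_map (e n) (E X (e m))
    rw [hWE X hX, hz, hz, map_smul, inner_smul_left, inner_smul_right, hE X hX, hE' X hX] at h1
    have h2 : conj (z n : ℂ) * z m * ⟪h' n, h' m⟫_ℂ = ⟪h n, h m⟫_ℂ :=
      mul_right_cancel₀ hne (by linear_combination h1)
    rw [inner_smul_left, inner_smul_right, ← h2, Circle.coe_inv_eq_conj, Circle.coe_inv_eq_conj,
      Complex.conj_conj]
    linear_combination (-⟪h' n, h' m⟫_ℂ * (conj (z m : ℂ) * z m)) * conj_mul_self_circle (z n) -
      ⟪h' n, h' m⟫_ℂ * conj_mul_self_circle (z m)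
  · rintro ⟨z, hz⟩
    obtain ⟨W, hW⟩ := exists_linearIsometryEquiv_apply_e fun n => (z n)⁻¹
    simp_rw [Circle.coe_inv_eq_conj] at hW
    refine ⟨W, fun a f => ?_, fun X hX f => ?_⟩
    · have : (W : L2 →L[ℂ] L2) ∘L U a = U a ∘L (W : L2 →L[ℂ] L2) := by
        refine clm_ext_e fun n => ?_
        change W (U a (e n)) = U a (W (e n))
        rw [U_apply_e, map_smul, hW, map_smul, U_apply_e, smul_comm]
      exact DFunLike.congr_fun this f
    · have : (W : L2 →L[ℂ] L2) ∘L (E X).toCLM = (E' X).toCLM ∘L (W : L2 →L[ℂ] L2) := by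
        refine clm_ext_inner_e fun n m => ?_
        have h1 : e n = (z n : ℂ) • W (e n) := by
          rw [hW, smul_smul, mul_comm, conj_mul_self_circle, one_smul]
        change ⟪e n, W (E X (e m))⟫_ℂ = ⟪e n, E' X (W (e m))⟫_ℂ
        rw [hW m, map_smul, inner_smul_right, hE' X hX, hz]
        conv_lhs => rw [h1]
        rw [inner_smul_left, W.inner_map_map, hE X hX, inner_smul_left, inner_smul_right]
        linear_combination (-conj (z n : ℂ) * ⟪h n, h m⟫_ℂ * moment X (m - n)) *
          conj_mul_self_circle (z m)
      exact DFunLike.congr_fun this f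

/-! ### Projection valued observables -/

theorem moment_neg (X : Set Circle) (k : ℤ) : moment X (-k) = conj (moment X k) := by
  rw [moment, moment, ← integral_conj]
  simp_rw [char_neg]

/-- The matrix entries of the square of a generated operator. -/
theorem IsGeneratedBy.hasSum_sq {E : OperatorMeasure} {h : ℤ → L2} (hE : IsGeneratedBy E h)
    {X : Set Circle} (hX : MeasurableSet X) (hsa : IsSelfAdjoint (E X).toCLM) (n m : ℤ) :
    HasSum (fun k => ⟪h n, h k⟫_ℂ * ⟪h k, h m⟫_ℂ * (moment X (k - n) * moment X (m - k)))
      ⟪e n, ((E X).toCLM * (E X).toCLM) (e m)⟫_ℂ := by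
  rw [isGeneratedBy_iff] at hE
  have hsym (f g : L2) : ⟪(E X).toCLM f, g⟫_ℂ = ⟪f, (E X).toCLM g⟫_ℂ := hsa.isSymmetric f g
  have h1 := eBasis.hasSum_inner_mul_inner ((E X).toCLM (e n)) ((E X).toCLM (e m))
  rw [hsym] at h1
  refine h1.congr_fun fun k => ?_
  rw [coe_eBasis, hsym, ContinuousLinearMapWOT.toCLM_apply, ContinuousLinearMapWOT.toCLM_apply,
    hE X hX, hE X hX]
  ring

/-- Subtracting the diagonal entry of E X * E X = E X from Parseval for 1_X gives ∑ (1 -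
|⟨h_n|h_j⟩|²) |moment X (j - n)|² = 0, whose terms are all nonnegative. -/
theorem IsGeneratedBy.isProjectionValued_iff {E : OperatorMeasure} {h : ℤ → L2}
    (hE : IsGeneratedBy E h) (hh : ∀ n, ‖h n‖ = 1) :
    IsProjectionValued E ↔
      ∃ (g : L2) (z : ℤ → Circle), ‖g‖ = 1 ∧ ∀ n, h n = (z n : ℂ) • g := by
  have hE' := isGeneratedBy_iff.mp hE
  constructor
  · intro hP
    have hnorm (n k : ℤ) : ‖⟪h n, h k⟫_ℂ‖ = 1 := by
      -- X depends on k, chosen so that the k-th term forces |⟨h_n|h_k⟩| = 1.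
      obtain ⟨X, hX, hne⟩ := exists_moment_ne_zero (k - n)
      have h1 := hE.hasSum_sq hX (hP X hX).isSelfAdjoint n n
      rw [(hP X hX).isIdempotentElem.eq, ContinuousLinearMapWOT.toCLM_apply, hE' X hX,
        inner_self_eq_norm_sq_to_K, hh] at h1
      have h2 := hasSum_moment_mul_moment hX n n
      have h3 := Complex.hasSum_re (h2.sub h1)
      have hmm (j : ℤ) : moment X (j - n) * moment X (n - j) =
          ((‖moment X (j - n)‖ ^ 2 : ℝ) : ℂ) := by
        rw [← neg_sub j n, moment_neg, Complex.mul_conj, Complex.normSq_eq_norm_sq]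
      have hhh (j : ℤ) : ⟪h n, h j⟫_ℂ * ⟪h j, h n⟫_ℂ = ((‖⟪h n, h j⟫_ℂ‖ ^ 2 : ℝ) : ℂ) := by
        rw [← inner_conj_symm (h j), Complex.mul_conj, Complex.normSq_eq_norm_sq]
      have h4 : HasSum (fun j => (1 - ‖⟪h n, h j⟫_ℂ‖ ^ 2) * ‖moment X (j - n)‖ ^ 2) 0 := by
        convert h3 using 1
        · ext j
          rw [hhh, hmm, ← Complex.ofReal_mul, ← Complex.ofReal_sub, Complex.ofReal_re]
          ring
        · simp
      have hle (j : ℤ) : ‖⟪h n, h j⟫_ℂ‖ ≤ 1 := by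
        simpa [hh] using norm_inner_le_norm (𝕜 := ℂ) (h n) (h j)
      have h5 := (hasSum_zero_iff_of_nonneg fun j => mul_nonneg
        (sub_nonneg.mpr (pow_le_one₀ (norm_nonneg _) (hle j))) (sq_nonneg _)).mp h4
      have h6 := (mul_eq_zero.mp (congr_fun h5 k)).resolve_right
        (pow_ne_zero 2 (norm_ne_zero_iff.mpr hne))
      exact (pow_eq_one_iff_of_nonneg (norm_nonneg _) two_ne_zero).mp (sub_eq_zero.mp h6).symm
    refine ⟨h 0, fun n => ⟨⟪h 0, h n⟫_ℂ, mem_sphere_zero_iff_norm.mpr (hnorm 0 n)⟩, hh 0,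
      fun n => ?_⟩
    have h0 : h 0 ≠ 0 := norm_ne_zero_iff.mp (by rw [hh]; exact one_ne_zero)
    have hor : h 0 = 0 ∨ h n = (⟪h 0, h n⟫_ℂ / ⟪h 0, h 0⟫_ℂ) • h 0 :=
      -- Equality case of Cauchy-Schwarz.
      ((norm_inner_eq_norm_tfae ℂ (h 0) (h n)).out 0 1).mp (by rw [hnorm, hh, hh, one_mul])
    have := hor.resolve_left h0
    rwa [inner_self_eq_norm_sq_to_K, hh, RCLike.ofReal_one, one_pow, div_one] at this
  · rintro ⟨g, z, hg, hz⟩ X hX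
    have hsa : IsSelfAdjoint (E X).toCLM :=
      ((hE.isCovariantLocalization hh).positive X hX).isSelfAdjoint
    refine ⟨clm_ext_inner_e fun n m => ?_, hsa⟩
    have hin (n m : ℤ) : ⟪h n, h m⟫_ℂ = conj (z n : ℂ) * z m := by
      rw [hz, hz, inner_smul_left, inner_smul_right, inner_self_eq_norm_sq_to_K, hg]
      simp
    refine (hE.hasSum_sq hX hsa n m).unique ?_
    rw [ContinuousLinearMapWOT.toCLM_apply, hE' X hX]
    -- The phase of the intermediate index k cancels, leaving Parseval for 1_X.
    refine ((hasSum_moment_mul_moment hX n m).mul_left ⟪h n, h m⟫_ℂ).congr_fun fun k => ?_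
    rw [hin, hin, hin]
    linear_combination (conj (z n : ℂ) * z m * (moment X (k - n) * moment X (m - k))) *
      conj_mul_self_circle (z k)

end TorusLocalization

theorem mainTheorem1 :
    -- the covariant localization observables are exactly the operator measures of the given form
    (∀ E : TorusLocalization.OperatorMeasure,
      TorusLocalization.IsCovariantLocalization E ↔
        ∃ h : ℤ → TorusLocalization.L2,
          (∀ n, ‖h n‖ = 1) ∧ TorusLocalization.IsGeneratedBy E h) ∧
    -- every sequence of unit vectors determines exactly one of them
    (∀ h : ℤ → TorusLocalization.L2, (∀ n, ‖h n‖ = 1) →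
      ∃! E : TorusLocalization.OperatorMeasure, TorusLocalization.IsGeneratedBy E h) ∧
    -- two sequences determine the same observable iff their Gram matrices agree
    (∀ h k : ℤ → TorusLocalization.L2, (∀ n, ‖h n‖ = 1) → (∀ n, ‖k n‖ = 1) →
      ∀ E F : TorusLocalization.OperatorMeasure,
        TorusLocalization.IsGeneratedBy E h → TorusLocalization.IsGeneratedBy F k →
        (E = F ↔ ∀ n m : ℤ, ⟪h n, h m⟫_ℂ = ⟪k n, k m⟫_ℂ)) ∧
    -- equivalence of two observables
    (∀ h h' : ℤ → TorusLocalization.L2, (∀ n, ‖h n‖ = 1) → (∀ n, ‖h' n‖ = 1) →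
      ∀ E E' : TorusLocalization.OperatorMeasure,
        TorusLocalization.IsGeneratedBy E h → TorusLocalization.IsGeneratedBy E' h' →
        (TorusLocalization.AreEquivalent E E' ↔
          ∃ z : ℤ → Circle, ∀ n m : ℤ,
            ⟪h' n, h' m⟫_ℂ = ⟪(z n : ℂ) • h n, (z m : ℂ) • h m⟫_ℂ)) ∧
    -- projection valued observables
    (∀ h : ℤ → TorusLocalization.L2, (∀ n, ‖h n‖ = 1) →
      ∀ E : TorusLocalization.OperatorMeasure, TorusLocalization.IsGeneratedBy E h →
        (TorusLocalization.IsProjectionValued E ↔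
          ∃ (g : TorusLocalization.L2) (z : ℤ → Circle),
            ‖g‖ = 1 ∧ ∀ n : ℤ, h n = (z n : ℂ) • g)) := by
  open TorusLocalization in
  exact ⟨fun E => ⟨fun hE => hE.exists_isGeneratedBy,
      fun ⟨_, hh, hE⟩ => hE.isCovariantLocalization hh⟩,
    fun _ hh => ⟨generatedMeasure hh, isGeneratedBy_generatedMeasure hh,
      fun _ hF => hF.eq_generatedMeasure hh⟩,
    fun _ _ _ _ _ _ hE hF => hE.eq_iff hF,
    fun _ _ _ _ _ _ hE hE' => hE.areEquivalent_iff hE',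
    fun _ hh _ hE => hE.isProjectionValued_iff hh⟩
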